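/- Let $d\ge 1$ and let $\phi:(0,\infty)\to(0,\infty)$ be a Bernstein function with $\phi(0+)=0$, without drift, and with $\phi(1)=1$, that is, $\phi(\lambda)=\int_{(0,\infty)}(1-e^{-\lambda s})\,\mu(ds)$ for all $\lambda>0$, where $\mu$ is a measure on $(0,\infty)$ with $\int_{(0,\infty)}(1\wedge s)\,\mu(ds)<\infty$. Suppose that $\phi$ satisfies (H1) there are constants $0<\delta_1\le\delta_2<1$ and $a_1,a_2>0$ such that $a_1\lambda^{\delta_1}\phi(t)\le\phi(\lambda t)\le a_2\lambda^{\delta_2}\phi(t)$ for all $\lambda\ge1$, $t\ge1$. Let $S=(S_t)_{t\ge0}$ be a subordinator (an increasing Lévy process with values in $[0,\infty)$ and $S_0=0$) with Laplace exponent $\phi$, i.e. $\mathbb E[e^{-\lambda S_t}]=e^{-t\phi(\lambda)}$ for $\lambda>0$, let $W=(W_t)_{t\ge0}$ be a Brownian motion in $\mathbb R^d$ independent of $S$, with $W_0=0$ and $\mathbb E[e^{i\xi\cdot W_t}]=e^{-t|\xi|^2}$, and let $X_t:=W_{S_t}$ be the subordinate Brownian motion. For $t>0$ let $$p(t,x)=(2\pi)^{-d}\int_{\mathbb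 R^d}e^{i\xi\cdot x}e^{-t\phi(|\xi|^2)}\,d\xi ,\qquad x\in\mathbb R^d.$$ Then $p$ is the transition density of $X$, i.e. for all $s\ge0$ and $t>0$ the increment $X_{s+t}-X_s$ has density $p(t,\cdot)$ with respect to Lebesgue measure, and for each $T>0$ there is a constant $N=N(T,d,\phi)>0$ such that for all $(t,x)\in(0,T]\times\mathbb R^d$ $$p(t,x)\le N\left(\left(\phi^{-1}(t^{-1})\right)^{d/2}\wedge t\,\frac{\phi(|x|^{-2})}{|x|^d}\right),$$ where $\phi^{-1}$ is the inverse of $\phi:(0,\infty)\to(0,\infty)$ and, for $x=0$, the second term of the minimum is read as $+\infty$. -/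

import Mathlib

open MeasureTheory ProbabilityTheory Filter Topology
open scoped NNReal ENNReal

noncomputable section

namespace SubordinateBM

/-- A Lévy measure of a subordinator: a measure carried by `(0, ∞)` with
`∫ (1 ∧ t) μ(dt) < ∞`. -/
structure IsLevyMeasure (μ : Measure ℝ) : Prop where
  carrier : μ (Set.Iic 0) = 0
  finite : ∫⁻ t, ENNReal.ofReal (min 1 t) ∂μ < ∞

/-- `φ` is, on `(0, ∞)`, the Bernstein function with `φ(0+) = 0`, drift `b` and Lévy measure `μ`:
`φ(l) = b l + ∫ (1 - e^{-l t}) μ(dt)`. The values of `φ` on `(-∞, 0]` are irrelevant. -/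
structure IsBernsteinWith (φ : ℝ → ℝ) (b : ℝ) (μ : Measure ℝ) : Prop where
  drift_nonneg : 0 ≤ b
  levy : IsLevyMeasure μ
  repr : ∀ l : ℝ, 0 < l → φ l = b * l + ∫ t, (1 - Real.exp (-(l * t))) ∂μ

/-- A Bernstein function with `φ(0+) = 0` and no drift. -/
def IsDriftlessBernstein (φ : ℝ → ℝ) : Prop :=
  ∃ μ : Measure ℝ, IsBernsteinWith φ 0 μ

/-- Condition (H1): weak scaling of `φ` at infinity. -/
def H1 (φ : ℝ → ℝ) : Prop :=
  ∃ δ₁ δ₂ a₁ a₂ : ℝ, 0 < δ₁ ∧ δ₁ ≤ δ₂ ∧ δ₂ < 1 ∧ 0 < a₁ ∧ 0 < a₂ ∧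
    ∀ l t : ℝ, 1 ≤ l → 1 ≤ t →
      a₁ * l ^ δ₁ * φ t ≤ φ (l * t) ∧ φ (l * t) ≤ a₂ * l ^ δ₂ * φ t

/-- The inverse of `φ` as a function on `(0, ∞)`. -/
def inverse (φ : ℝ → ℝ) : ℝ → ℝ :=
  Function.invFunOn φ (Set.Ioi 0)

variable {Ω : Type*} [MeasurableSpace Ω]

/-- A subordinator: a Lévy process with values in `[0, ∞)`, started at `0`, with increasing
paths. The paths are right-continuous; being increasing, they have left limits. -/
structure IsSubordinator (S : ℝ≥0 → Ω → ℝ≥0) (P : Measure Ω) : Prop where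
  measurable : ∀ t, Measurable (S t)
  zero : ∀ᵐ ω ∂P, S 0 ω = 0
  indep : HasIndepIncrements (fun t ω => (S t ω : ℝ)) P
  stationary : ∀ s t : ℝ≥0,
    P.map (fun ω => (S (s + t) ω : ℝ) - S s ω) = P.map (fun ω => (S t ω : ℝ))
  monotone : ∀ᵐ ω ∂P, Monotone (fun t => S t ω)
  rightCont : ∀ᵐ ω ∂P, ∀ t, ContinuousWithinAt (fun r => S r ω) (Set.Ici t) t

/-- `φ` is the Laplace exponent of `S`: `E[exp(-l S_t)] = exp(-t φ(l))` for `l > 0`. -/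
def HasLaplaceExponent (S : ℝ≥0 → Ω → ℝ≥0) (P : Measure Ω) (φ : ℝ → ℝ) : Prop :=
  ∀ (t : ℝ≥0) (l : ℝ), 0 < l →
    ∫ ω, Real.exp (-(l * (S t ω : ℝ))) ∂P = Real.exp (-((t : ℝ) * φ l))

/-- A `d`-dimensional Brownian motion started at `0`, run at twice the usual speed:
`E[exp(i ξ · (W_{s+t} - W_s))] = exp(-t |ξ|²)`. -/
structure IsBrownianMotion {d : ℕ} (W : ℝ≥0 → Ω → EuclideanSpace ℝ (Fin d))
    (P : Measure Ω) : Prop where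
  measurable : ∀ t, Measurable (W t)
  zero : ∀ᵐ ω ∂P, W 0 ω = 0
  indep : HasIndepIncrements W P
  charFun_increment : ∀ (s t : ℝ≥0) (ξ : EuclideanSpace ℝ (Fin d)),
    charFun (P.map (fun ω => W (s + t) ω - W s ω)) ξ = Complex.exp (-((t : ℝ) * ‖ξ‖ ^ 2 : ℝ))
  continuous : ∀ᵐ ω ∂P, Continuous (fun t => W t ω)

/-- The subordinate process `X_t = W_{S_t}`. -/
def subordinate {d : ℕ} (W : ℝ≥0 → Ω → EuclideanSpace ℝ (Fin d)) (S : ℝ≥0 → Ω → ℝ≥0)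
    (t : ℝ≥0) (ω : Ω) : EuclideanSpace ℝ (Fin d) :=
  W (S t ω) ω

/-- `p(t,x) = (2π)^{-d} ∫ e^{i ξ · x} e^{-t φ(|ξ|²)} dξ`. The integral is real by symmetry. -/
def transitionDensity {d : ℕ} (φ : ℝ → ℝ) (t : ℝ) (x : EuclideanSpace ℝ (Fin d)) : ℝ :=
  ((2 * Real.pi) ^ d)⁻¹ *
    (∫ ξ : EuclideanSpace ℝ (Fin d),
      Complex.exp (Complex.I * (inner ℝ ξ x : ℝ)) *
        (Real.exp (-(t * φ (‖ξ‖ ^ 2))) : ℂ)).re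

end SubordinateBM

end

/-! Let `ν` be the law of `S_t`; its Laplace transform is `exp (-t φ)`. Given the random times, an
increment of `X` is Gaussian, so its law is a mixture of Gaussian kernels `g_s` over `ν(ds)`. Fubini
inverts the Fourier transform of this mixture and identifies its density with `p(t, ·)`
(`transitionDensity_eq_gaussMixture`, `map_subordinate_sub`).

On the diagonal, `p(t, x)` is at most the integral of `exp (-t φ(|ξ|²))`. With `R = φ⁻¹(1/t)`, lower
scaling from `R` on gives `t φ(|ξ|²) ≥ c (|ξ|²/R)^δ - c`, and the substitution `ξ = √R η` produces
`R^(d/2)` (`exists_integral_bound`).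

Off the diagonal no estimate of jumps is needed. The kernel satisfies `g_s(x) ≤ K |x|⁻ᵈ (1 - exp
(-s/|x|²))` with `K` depending only on `d` (`gaussKernel_le`). Integration against `ν` turns the
bracket into `1 - exp (-t φ(|x|⁻²)) ≤ t φ(|x|⁻²)`. -/

namespace SubordinateBM

/-! ### Bernstein functions, their inverse and scaling -/

section Bernstein

variable {μ : Measure ℝ} {φ : ℝ → ℝ}

lemma IsLevyMeasure.ae_pos (h : IsLevyMeasure μ) : ∀ᵐ s ∂μ, 0 < s := by
  have := h.carrier
  rw [ae_iff]
  convert this using 2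
  ext s
  simp

lemma IsLevyMeasure.integrable_min (h : IsLevyMeasure μ) : Integrable (fun s : ℝ => min 1 s) μ := by
  refine ⟨by fun_prop, ?_⟩
  rw [hasFiniteIntegral_iff_ofReal]
  · exact h.finite
  · filter_upwards [h.ae_pos] with s hs
    simp [hs.le]

lemma one_sub_exp_neg_nonneg {l s : ℝ} (hl : 0 ≤ l) (hs : 0 ≤ s) :
    0 ≤ 1 - Real.exp (-(l * s)) := by
  have : Real.exp (-(l * s)) ≤ 1 := Real.exp_le_one_iff.2 (by nlinarith [mul_nonneg hl hs])
  linarith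

/-- Uniformity in `l ≤ M` makes the right side a dominating function both for integrability and for
continuity in `l`. -/
lemma one_sub_exp_neg_le {l M s : ℝ} (hlM : l ≤ M) (hM : 1 ≤ M) (hs : 0 ≤ s) :
    1 - Real.exp (-(l * s)) ≤ M * min 1 s := by
  rcases le_total 1 s with h | h
  · rw [min_eq_left h]
    have := Real.exp_pos (-(l * s))
    linarith
  · rw [min_eq_right h]
    have := Real.add_one_le_exp (-(l * s))
    nlinarith [mul_le_mul_of_nonneg_right hlM hs]

lemma norm_one_sub_exp_neg_le {l M s : ℝ} (hl : 0 ≤ l) (hlM : l ≤ M) (hM : 1 ≤ M) (hs : 0 ≤ s) :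
    ‖1 - Real.exp (-(l * s))‖ ≤ M * min 1 s := by
  rw [Real.norm_of_nonneg (one_sub_exp_neg_nonneg hl hs)]
  exact one_sub_exp_neg_le hlM hM hs

lemma IsLevyMeasure.integrable_one_sub_exp (h : IsLevyMeasure μ) {l : ℝ} (hl : 0 ≤ l) :
    Integrable (fun s => 1 - Real.exp (-(l * s))) μ := by
  refine Integrable.mono' (h.integrable_min.const_mul (max 1 l)) (by fun_prop) ?_
  filter_upwards [h.ae_pos] with s hs
  exact norm_one_sub_exp_neg_le hl (le_max_right _ _) (le_max_left _ _) hs.le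

lemma IsLevyMeasure.continuousOn_integral (h : IsLevyMeasure μ) :
    ContinuousOn (fun l : ℝ => ∫ s, (1 - Real.exp (-(l * s))) ∂μ) (Set.Ici 0) := by
  intro l hl
  refine continuousWithinAt_of_dominated (bound := fun s => (max 1 (l + 1)) * min 1 s) ?_ ?_
    (h.integrable_min.const_mul _) ?_
  · exact Eventually.of_forall fun x => by fun_prop
  · have : ∀ᶠ x in 𝓝[Set.Ici 0] l, x < l + 1 :=
      mem_nhdsWithin_of_mem_nhds (Iio_mem_nhds (by linarith))
    filter_upwards [this, self_mem_nhdsWithin] with x hx hx0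
    filter_upwards [h.ae_pos] with s hs
    exact norm_one_sub_exp_neg_le hx0 (hx.le.trans (le_max_right _ _)) (le_max_left _ _) hs.le
  · exact Eventually.of_forall fun s => by fun_prop

lemma IsBernsteinWith.eq_integral (h : IsBernsteinWith φ 0 μ) {l : ℝ} (hl : 0 < l) :
    φ l = ∫ s, (1 - Real.exp (-(l * s))) ∂μ := by
  rw [h.repr l hl]; simp

namespace IsDriftlessBernstein

lemma nonneg (h : IsDriftlessBernstein φ) {l : ℝ} (hl : 0 < l) : 0 ≤ φ l := by
  obtain ⟨μ, h⟩ := h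
  rw [h.eq_integral hl]
  refine integral_nonneg_of_ae ?_
  filter_upwards [h.levy.ae_pos] with s hs
  exact one_sub_exp_neg_nonneg hl.le hs.le

lemma monotoneOn (h : IsDriftlessBernstein φ) : MonotoneOn φ (Set.Ioi 0) := by
  obtain ⟨μ, h⟩ := h
  intro a ha b hb hab
  rw [h.eq_integral ha, h.eq_integral hb]
  refine integral_mono_ae (h.levy.integrable_one_sub_exp (le_of_lt ha))
    (h.levy.integrable_one_sub_exp (le_of_lt hb)) ?_
  filter_upwards [h.levy.ae_pos] with s hs
  have : Real.exp (-(b * s)) ≤ Real.exp (-(a * s)) := Real.exp_le_exp.2 (by nlinarith)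
  exact sub_le_sub_left this 1

lemma continuousOn (h : IsDriftlessBernstein φ) : ContinuousOn φ (Set.Ioi 0) := by
  obtain ⟨μ, h⟩ := h
  exact (h.levy.continuousOn_integral.mono Set.Ioi_subset_Ici_self).congr
    fun l hl => h.eq_integral hl

lemma tendsto_zero (h : IsDriftlessBernstein φ) : Tendsto φ (𝓝[>] 0) (𝓝 0) := by
  obtain ⟨μ, h⟩ := h
  -- The integral is continuous up to `l = 0` and vanishes there, whatever the value `φ 0` is.
  have h0 := (h.levy.continuousOn_integral 0 Set.self_mem_Ici).tendsto
  simp only [zero_mul, neg_zero, Real.exp_zero, sub_self, integral_zero] at h0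
  refine (h0.mono_left (nhdsWithin_mono _ Set.Ioi_subset_Ici_self)).congr' ?_
  filter_upwards [self_mem_nhdsWithin] with l hl
  exact (h.eq_integral hl).symm

lemma exists_pos_lt (h : IsDriftlessBernstein φ) {y : ℝ} (hy : 0 < y) :
    ∃ r : ℝ, 0 < r ∧ r ≤ 1 ∧ φ r < y := by
  have h1 : ∀ᶠ r in 𝓝[>] (0 : ℝ), φ r < y := h.tendsto_zero.eventually_lt_const hy
  have h2 : ∀ᶠ r in 𝓝[>] (0 : ℝ), r < 1 := mem_nhdsWithin_of_mem_nhds (Iio_mem_nhds one_pos)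
  obtain ⟨r, ⟨hr1, hr2⟩, hr3⟩ := ((h1.and h2).and self_mem_nhdsWithin).exists
  exact ⟨r, hr3, hr2.le, hr1⟩

lemma tendsto_atTop (h1 : φ 1 = 1) (hH : H1 φ) : Tendsto φ atTop atTop := by
  obtain ⟨δ₁, δ₂, a₁, a₂, hδ, -, -, ha, -, H⟩ := hH
  refine tendsto_atTop_mono' _ ?_ ((tendsto_rpow_atTop hδ).const_mul_atTop ha)
  filter_upwards [eventually_ge_atTop 1] with l hl
  simpa [h1] using (H l 1 hl le_rfl).1

/-- The intermediate value theorem between `φ(0+) = 0` and `φ(∞) = ∞`. Surjectivity alone makes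
`inverse φ` a right inverse, which is all that the estimates use. -/
lemma exists_eq (h : IsDriftlessBernstein φ) (h1 : φ 1 = 1) (hH : H1 φ) {y : ℝ} (hy : 0 < y) :
    ∃ r ∈ Set.Ioi (0 : ℝ), φ r = y := by
  obtain ⟨r, hr, hr1, hry⟩ := h.exists_pos_lt hy
  obtain ⟨R, hR, hyR⟩ := ((eventually_ge_atTop r).and
    ((tendsto_atTop h1 hH).eventually_ge_atTop y)).exists
  obtain ⟨z, hz, hzy⟩ := intermediate_value_Icc hR
    (h.continuousOn.mono fun z hz => lt_of_lt_of_le hr hz.1) ⟨hry.le, hyR⟩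
  exact ⟨z, lt_of_lt_of_le hr hz.1, hzy⟩

lemma inverse_pos (h : IsDriftlessBernstein φ) (h1 : φ 1 = 1) (hH : H1 φ) {y : ℝ} (hy : 0 < y) :
    0 < inverse φ y :=
  Function.invFunOn_mem (h.exists_eq h1 hH hy)

lemma apply_inverse (h : IsDriftlessBernstein φ) (h1 : φ 1 = 1) (hH : H1 φ) {y : ℝ} (hy : 0 < y) :
    φ (inverse φ y) = y :=
  Function.invFunOn_eq (h.exists_eq h1 hH hy)

/-- The lower scaling bound holds from any `r > 0` on, with a constant that depends on `r`. -/
lemma exists_lower_scaling (h : IsDriftlessBernstein φ) (h1 : φ 1 = 1) (hH : H1 φ)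
    {r : ℝ} (hr : 0 < r) (hr1 : r ≤ 1) :
    ∃ δ c : ℝ, 0 < δ ∧ 0 < c ∧ ∀ l R : ℝ, 1 ≤ l → r ≤ R → c * l ^ δ * φ R ≤ φ (l * R) := by
  obtain ⟨δ, δ₂, a, a₂, hδ, -, -, ha, -, H⟩ := hH
  have hrδ : r ^ δ ≤ 1 := Real.rpow_le_one hr.le hr1 hδ.le
  have hrδ0 : 0 < r ^ δ := Real.rpow_pos_of_pos hr δ
  -- For `R ≥ 1` this is (H1). If `R ≤ 1 ≤ l R`, (H1) is applied from `1`, with `φ R ≤ 1` and `r l ≤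
  -- l R`. If `l R ≤ 1`, the factor in front of `φ R` is at most `1` and monotonicity suffices.
  refine ⟨δ, min a 1 * r ^ δ, hδ, by positivity, fun l R hl hR => ?_⟩
  have hR0 : 0 < R := hr.trans_le hR
  have hl0 : 0 < l := one_pos.trans_le hl
  have hφR := h.nonneg hR0
  have hlδ : 0 < l ^ δ := Real.rpow_pos_of_pos hl0 δ
  rcases le_total 1 R with hR1 | hR1
  · refine le_trans ?_ (H l R hl hR1).1
    gcongr
    calc min a 1 * r ^ δ ≤ a * 1 := by gcongr; exact min_le_left _ _
      _ = a := mul_one a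
  · have hφR1 : φ R ≤ 1 := h1 ▸ h.monotoneOn hR0 (Set.mem_Ioi.2 one_pos) hR1
    have hRl : r ^ δ * l ^ δ ≤ (l * R) ^ δ := by
      rw [← Real.mul_rpow hr.le hl0.le, mul_comm]
      gcongr
    rcases le_total 1 (l * R) with hlR | hlR
    · have := (H (l * R) 1 hlR le_rfl).1
      rw [mul_one, h1, mul_one] at this
      refine le_trans ?_ this
      calc min a 1 * r ^ δ * l ^ δ * φ R ≤ min a 1 * r ^ δ * l ^ δ * 1 := by gcongr
        _ = min a 1 * (r ^ δ * l ^ δ) := by ring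
        _ ≤ a * (l * R) ^ δ := by gcongr; exact min_le_left _ _
    · have hm : φ R ≤ φ (l * R) := h.monotoneOn hR0 (mul_pos hl0 hR0) (by nlinarith)
      refine le_trans ?_ hm
      have h2 : (l * R) ^ δ ≤ 1 := Real.rpow_le_one (by positivity) hlR hδ.le
      calc min a 1 * r ^ δ * l ^ δ * φ R = min a 1 * (r ^ δ * l ^ δ) * φ R := by ring
        _ ≤ 1 * 1 * φ R := by gcongr; exacts [min_le_right _ _, hRl.trans h2]
        _ = φ R := by ring

end IsDriftlessBernstein

end Bernstein

/-! ### Integrability of the symbol and the on-diagonal bound -/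

section Exponential

variable {E : Type*} [NormedAddCommGroup E] [NormedSpace ℝ E] [FiniteDimensional ℝ E]
  [MeasurableSpace E] [BorelSpace E] [Nontrivial E]

lemma integrable_exp_neg_mul_norm_rpow (μ : Measure E) [μ.IsAddHaarMeasure] {c p : ℝ} (hc : 0 < c)
    (hp : 0 < p) : Integrable (fun x : E => Real.exp (-c * ‖x‖ ^ p)) μ := by
  rw [integrable_fun_norm_addHaar μ (f := fun r => Real.exp (-c * r ^ p))]
  have := integrableOn_rpow_mul_exp_neg_mul_rpow
    (s := ((Module.finrank ℝ E - 1 : ℕ) : ℝ)) (lt_of_lt_of_le (by norm_num) (Nat.cast_nonneg _)) hp hc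
  simpa [Real.rpow_natCast] using this

end Exponential

namespace IsDriftlessBernstein

variable {φ : ℝ → ℝ} {d : ℕ}

/-- A stretched exponential bound for the symbol on the scale `φ⁻¹(1/t)`. -/
lemma exists_exp_bound (h : IsDriftlessBernstein φ) (h1 : φ 1 = 1) (hH : H1 φ)
    {T : ℝ} (hT : 0 < T) :
    ∃ p c : ℝ, 0 < p ∧ 0 < c ∧ ∀ t : ℝ, 0 < t → t ≤ T → ∀ r : ℝ, 0 < r →
      Real.exp (-(t * φ (r ^ 2))) ≤
        Real.exp c * Real.exp (-c * ((√(inverse φ t⁻¹))⁻¹ * r) ^ p) := by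
  -- Since `φ r₀ < 1/T ≤ 1/t`, the scale `R = φ⁻¹(1/t)` stays above `r₀` for all `t ≤ T`, so one
  -- scaling constant serves them all.
  obtain ⟨r₀, hr₀, hr₀1, hr₀T⟩ := h.exists_pos_lt (inv_pos.2 hT)
  obtain ⟨δ, c, hδ, hc, H⟩ := h.exists_lower_scaling h1 hH hr₀ hr₀1
  refine ⟨2 * δ, c, by positivity, hc, fun t ht htT r hr => ?_⟩
  have hR := h.inverse_pos h1 hH (inv_pos.2 ht)
  have hφR := h.apply_inverse h1 hH (inv_pos.2 ht)
  set R := inverse φ t⁻¹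
  have hr₀R : r₀ ≤ R := by
    by_contra! hlt
    have := h.monotoneOn hR hr₀ hlt.le
    rw [hφR] at this
    exact absurd (hr₀T.trans_le (inv_anti₀ ht htT)) (not_lt.2 this)
  have hu : 0 ≤ (√R)⁻¹ * r := by positivity
  have hpow : ((√R)⁻¹ * r) ^ (2 * δ) = (r ^ 2 / R) ^ δ := by
    rw [Real.rpow_mul hu, Real.rpow_two, mul_pow, inv_pow, Real.sq_sqrt hR.le]
    congr 1; ring
  rw [hpow, ← Real.exp_add, Real.exp_le_exp]
  -- Scaling from `R` applies when `r² ≥ R`. When `r² ≤ R`, the factor `exp c` makes the right side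
  -- at least `1`.
  rcases le_total 1 (r ^ 2 / R) with hl | hl
  · have := H (r ^ 2 / R) R hl hr₀R
    rw [div_mul_cancel₀ _ hR.ne', hφR] at this
    have h2 : c * (r ^ 2 / R) ^ δ ≤ t * φ (r ^ 2) := by
      calc c * (r ^ 2 / R) ^ δ = t * (c * (r ^ 2 / R) ^ δ * t⁻¹) := by field_simp
        _ ≤ _ := by gcongr
    linarith
  · have h2 : (r ^ 2 / R) ^ δ ≤ 1 := Real.rpow_le_one (by positivity) hl hδ.le
    have h3 : 0 ≤ t * φ (r ^ 2) := mul_nonneg ht.le (h.nonneg (by positivity))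
    nlinarith

/-- The symbol is integrable, and its integral is of the order of the on-diagonal bound. -/
lemma exists_integral_bound (h : IsDriftlessBernstein φ) (h1 : φ 1 = 1) (hH : H1 φ) (hd : 1 ≤ d)
    {T : ℝ} (hT : 0 < T) :
    ∃ C : ℝ, 0 < C ∧ ∀ t : ℝ, 0 < t → t ≤ T →
      Integrable (fun ξ : EuclideanSpace ℝ (Fin d) => Real.exp (-(t * φ (‖ξ‖ ^ 2)))) ∧
      ∫ ξ : EuclideanSpace ℝ (Fin d), Real.exp (-(t * φ (‖ξ‖ ^ 2))) ≤
        C * (inverse φ t⁻¹) ^ ((d : ℝ) / 2) := by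
  obtain ⟨p, c, hp, hc, H⟩ := h.exists_exp_bound h1 hH hT
  have : Nonempty (Fin d) := ⟨⟨0, hd⟩⟩
  let f : EuclideanSpace ℝ (Fin d) → ℝ := fun ξ => Real.exp c * Real.exp (-c * ‖ξ‖ ^ p)
  have hf : Integrable f := (integrable_exp_neg_mul_norm_rpow volume hc hp).const_mul _
  have hf0 : 0 ≤ ∫ ξ, f ξ := integral_nonneg fun ξ => by positivity
  -- The summand `1` only makes the constant visibly positive.
  refine ⟨(∫ ξ, f ξ) + 1, by positivity, fun t ht htT => ?_⟩
  have hR := h.inverse_pos h1 hH (inv_pos.2 ht)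
  have hb := H t ht htT
  set R := inverse φ t⁻¹
  have hsR : 0 < √R := Real.sqrt_pos.2 hR
  have hfs : Integrable fun ξ => f ((√R)⁻¹ • ξ) := hf.comp_smul (inv_pos.2 hsR).ne'
  -- At `ξ = 0` the symbol involves the arbitrary value `φ 0`; as `d ≥ 1`, this point is null.
  have hne : ∀ᵐ ξ : EuclideanSpace ℝ (Fin d), ξ ≠ 0 := by
    simp [ae_iff]
  have hle : ∀ᵐ ξ : EuclideanSpace ℝ (Fin d),
      Real.exp (-(t * φ (‖ξ‖ ^ 2))) ≤ f ((√R)⁻¹ • ξ) := by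
    filter_upwards [hne] with ξ hξ
    have := hb ‖ξ‖ (norm_pos_iff.2 hξ)
    simpa [f, norm_smul, abs_of_pos hsR] using this
  have hmeas : AEStronglyMeasurable
      (fun ξ : EuclideanSpace ℝ (Fin d) => Real.exp (-(t * φ (‖ξ‖ ^ 2)))) := by
    have hco : ContinuousOn (fun ξ : EuclideanSpace ℝ (Fin d) => Real.exp (-(t * φ (‖ξ‖ ^ 2))))
        {0}ᶜ := by
      refine Real.continuous_exp.comp_continuousOn (ContinuousOn.neg (ContinuousOn.mul
        continuousOn_const (h.continuousOn.comp (by fun_prop) ?_)))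
      intro ξ hξ
      exact pow_pos (norm_pos_iff.2 hξ) 2
    have := hco.aestronglyMeasurable (μ := volume) (measurableSet_singleton _).compl
    rwa [Measure.restrict_eq_self_of_ae_mem (s := {0}ᶜ) hne] at this
  have hint : Integrable
      (fun ξ : EuclideanSpace ℝ (Fin d) => Real.exp (-(t * φ (‖ξ‖ ^ 2)))) := by
    refine hfs.mono' hmeas ?_
    filter_upwards [hle] with ξ hξ
    rwa [Real.norm_of_nonneg (Real.exp_pos _).le]
  refine ⟨hint, (integral_mono_ae hint hfs hle).trans ?_⟩
  rw [Measure.integral_comp_inv_smul]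
  have hRd : √R ^ d = R ^ ((d : ℝ) / 2) := by
    rw [Real.sqrt_eq_rpow, ← Real.rpow_natCast, ← Real.rpow_mul hR.le]
    congr 1; ring
  rw [finrank_euclideanSpace_fin, abs_of_pos (by positivity), hRd, smul_eq_mul, mul_comm]
  gcongr
  linarith

end IsDriftlessBernstein

end SubordinateBM

namespace SubordinateBM

/-! ### The Gaussian kernel -/

section Gaussian

variable {d : ℕ}

/-- The density of a Gaussian vector with characteristic function `exp (-s |ξ|²)`. -/
noncomputable def gaussKernel (s : ℝ) (x : EuclideanSpace ℝ (Fin d)) : ℝ :=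
  ((2 * Real.pi) ^ d)⁻¹ * ((Real.pi / s) ^ ((d : ℝ) / 2) * Real.exp (-(‖x‖ ^ 2 / (4 * s))))

lemma gaussKernel_nonneg {s : ℝ} (hs : 0 < s) (x : EuclideanSpace ℝ (Fin d)) :
    0 ≤ gaussKernel s x := by
  unfold gaussKernel
  have := Real.pi_pos
  positivity

lemma measurable_gaussKernel :
    Measurable fun p : ℝ × EuclideanSpace ℝ (Fin d) => gaussKernel p.1 p.2 := by
  unfold gaussKernel
  fun_prop

lemma integral_cexp_mul_exp_neg {s : ℝ} (hs : 0 < s) (x : EuclideanSpace ℝ (Fin d)) :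
    ∫ ξ : EuclideanSpace ℝ (Fin d),
      Complex.exp (Complex.I * (inner ℝ ξ x : ℝ)) * (Real.exp (-(‖ξ‖ ^ 2 * s)) : ℂ) =
      (((Real.pi / s) ^ ((d : ℝ) / 2) * Real.exp (-(‖x‖ ^ 2 / (4 * s))) : ℝ) : ℂ) := by
  have h := GaussianFourier.integral_cexp_neg_mul_sq_norm_add (b := (s : ℂ)) (by simpa using hs)
    Complex.I x
  rw [finrank_euclideanSpace_fin] at h
  push_cast
  rw [Complex.ofReal_cpow (by positivity)]
  push_cast
  convert h using 2
  · ext ξ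
    rw [← Complex.exp_add, real_inner_comm]
    ring_nf
  · congr 1
    rw [Complex.I_sq]
    ring

lemma integrable_exp_neg_mul_sq_norm {s : ℝ} (hs : 0 < s) :
    Integrable fun x : EuclideanSpace ℝ (Fin d) => Real.exp (-(‖x‖ ^ 2 * s)) := by
  have h := (GaussianFourier.integrable_cexp_neg_mul_sq_norm_add (b := (s : ℂ)) (by simpa using hs)
    0 (0 : EuclideanSpace ℝ (Fin d))).norm
  refine h.congr (Eventually.of_forall fun x => ?_)
  simp only [Complex.norm_exp]
  congr 1
  simp [← Complex.ofReal_pow, mul_comm]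

lemma integrable_gaussKernel {s : ℝ} (hs : 0 < s) :
    Integrable fun x : EuclideanSpace ℝ (Fin d) => gaussKernel s x := by
  unfold gaussKernel
  refine Integrable.const_mul (Integrable.const_mul ?_ _) _
  simpa only [div_eq_mul_inv] using
    integrable_exp_neg_mul_sq_norm (d := d) (s := (4 * s)⁻¹) (by positivity)

/-- The Gaussian Fourier integral with `s` replaced by `1/(4s)`; the constants cancel because
`(π/s)(4πs) = (2π)²`. -/
lemma integral_cexp_mul_gaussKernel {s : ℝ} (hs : 0 < s) (ξ : EuclideanSpace ℝ (Fin d)) :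
    ∫ x : EuclideanSpace ℝ (Fin d),
      Complex.exp (Complex.I * (inner ℝ x ξ : ℝ)) * (gaussKernel s x : ℂ) =
      (Real.exp (-(‖ξ‖ ^ 2 * s)) : ℂ) := by
  have h := integral_cexp_mul_exp_neg (s := (4 * s)⁻¹) (by positivity) ξ
  have hπ := Real.pi_pos
  have hc : ((2 * Real.pi) ^ d)⁻¹ * (Real.pi / s) ^ ((d : ℝ) / 2) *
      (Real.pi / (4 * s)⁻¹) ^ ((d : ℝ) / 2) = 1 := by
    rw [mul_assoc, ← Real.mul_rpow (by positivity) (by positivity)]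
    have : Real.pi / s * (Real.pi / (4 * s)⁻¹) = (2 * Real.pi) ^ (2 : ℝ) := by
      rw [Real.rpow_two]; field_simp; ring
    rw [this, ← Real.rpow_mul (by positivity), mul_div_cancel₀ _ two_ne_zero, Real.rpow_natCast]
    exact inv_mul_cancel₀ (by positivity)
  have he : ∀ x : EuclideanSpace ℝ (Fin d),
      Complex.exp (Complex.I * (inner ℝ x ξ : ℝ)) * (gaussKernel s x : ℂ) =
      ((((2 * Real.pi) ^ d)⁻¹ * (Real.pi / s) ^ ((d : ℝ) / 2) : ℝ) : ℂ) *
      (Complex.exp (Complex.I * (inner ℝ x ξ : ℝ)) *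
        (Real.exp (-(‖x‖ ^ 2 * (4 * s)⁻¹)) : ℂ)) := fun x => by
    unfold gaussKernel
    rw [div_eq_mul_inv (‖x‖ ^ 2)]
    push_cast
    ring
  simp_rw [he]
  rw [integral_const_mul, h, ← Complex.ofReal_mul, ← mul_assoc, hc, one_mul]
  congr 4
  field_simp

lemma integral_gaussKernel {s : ℝ} (hs : 0 < s) :
    ∫ x : EuclideanSpace ℝ (Fin d), gaussKernel s x = 1 := by
  have h := integral_cexp_mul_gaussKernel hs (0 : EuclideanSpace ℝ (Fin d))
  simp only [inner_zero_right, Complex.ofReal_zero, mul_zero, Complex.exp_zero, one_mul,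
    integral_complex_ofReal] at h
  simpa using h

/-- The Gaussian kernel is controlled by `|x|⁻ᵈ (1 - exp (-s/|x|²))`. -/
lemma gaussKernel_le {s : ℝ} (hs : 0 < s) {x : EuclideanSpace ℝ (Fin d)} (hx : x ≠ 0) :
    gaussKernel s x ≤
      4 * (d + 1).factorial * Real.exp 1 / ‖x‖ ^ d *
        (1 - Real.exp (-(‖x‖ ^ (-2 : ℤ) * s))) := by
  have hπ := Real.pi_pos
  have hr : 0 < ‖x‖ := norm_pos_iff.2 hx
  set r := ‖x‖ with hr_def
  set v := r ^ 2 / (4 * s) with hv_def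
  have hv : 0 < v := by positivity
  -- Here `π/s = 4πv/r²`. Powers of `v` are traded for powers of `1 + v`, which `exp (-v)` absorbs
  -- at the cost `(d+1)! e`.
  have hconst : ((2 * Real.pi) ^ d)⁻¹ * (Real.pi / s) ^ ((d : ℝ) / 2) ≤ (1 + v) ^ d / r ^ d := by
    have h1 : Real.pi / s = 4 * Real.pi * v / r ^ 2 := by rw [hv_def]; field_simp
    have h2 : (r ^ 2) ^ ((d : ℝ) / 2) = r ^ d := by
      rw [← Real.rpow_natCast r 2, ← Real.rpow_mul hr.le, Nat.cast_ofNat,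
        mul_div_cancel₀ _ two_ne_zero, Real.rpow_natCast]
    have h3 : (4 * Real.pi * v) ^ ((d : ℝ) / 2) ≤ (2 * Real.pi * (1 + v)) ^ d := by
      rw [← Real.rpow_natCast, ← mul_div_cancel₀ (d : ℝ) (two_ne_zero' ℝ),
        Real.rpow_mul (by positivity), mul_div_cancel₀ _ (two_ne_zero' ℝ), Real.rpow_two]
      refine Real.rpow_le_rpow (by positivity) ?_ (by positivity)
      have := Real.pi_gt_three
      calc 4 * Real.pi * v ≤ 4 * Real.pi * (1 + v) ^ 2 := by gcongr; nlinarith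
        _ ≤ 4 * Real.pi * (1 + v) ^ 2 * Real.pi := le_mul_of_one_le_right (by positivity) (by linarith)
        _ = _ := by ring
    rw [h1, Real.div_rpow (by positivity) (by positivity), h2, ← mul_div_assoc]
    gcongr
    calc ((2 * Real.pi) ^ d)⁻¹ * (4 * Real.pi * v) ^ ((d : ℝ) / 2)
        ≤ ((2 * Real.pi) ^ d)⁻¹ * (2 * Real.pi * (1 + v)) ^ d := by gcongr
      _ = (1 + v) ^ d := by rw [mul_pow (2 * Real.pi)]; field_simp
  have hexp : (1 + v) ^ (d + 1) ≤ (d + 1).factorial * (Real.exp 1 * Real.exp v) := by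
    have := Real.pow_div_factorial_le_exp (1 + v) (by positivity) (d + 1)
    rwa [div_le_iff₀' (by positivity), Real.exp_add] at this
  -- With `u = s/r² = 1/(4v)`, the bound `exp (-u) ≤ 1/(1+u)` gives `1 - exp (-u) ≥ 1/(1+4v)`.
  have hlow : (4 * (1 + v))⁻¹ ≤ 1 - Real.exp (-(r ^ (-2 : ℤ) * s)) := by
    have hu : r ^ (-2 : ℤ) * s = (4 * v)⁻¹ := by
      rw [hv_def, zpow_neg]; norm_cast; field_simp
    have h1 := Real.add_one_le_exp ((4 * v)⁻¹)
    rw [hu, Real.exp_neg]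
    have h2 : (Real.exp (4 * v)⁻¹)⁻¹ ≤ ((4 * v)⁻¹ + 1)⁻¹ := inv_anti₀ (by positivity) h1
    have h3 : 1 - ((4 * v)⁻¹ + 1)⁻¹ = (1 + 4 * v)⁻¹ := by field_simp; ring
    have h4 : (4 * (1 + v))⁻¹ ≤ (1 + 4 * v)⁻¹ := inv_anti₀ (by positivity) (by linarith)
    linarith
  have hv1 : 0 < 1 + v := by positivity
  unfold gaussKernel
  calc _ = ((2 * Real.pi) ^ d)⁻¹ * (Real.pi / s) ^ ((d : ℝ) / 2) * Real.exp (-v) := by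
        rw [mul_assoc]
    _ ≤ (1 + v) ^ d / r ^ d * Real.exp (-v) := by gcongr
    _ = 4 * (1 + v) ^ (d + 1) * Real.exp (-v) / r ^ d * (4 * (1 + v))⁻¹ := by
        rw [pow_succ]; field_simp
    _ ≤ 4 * ((d + 1).factorial * (Real.exp 1 * Real.exp v)) * Real.exp (-v) / r ^ d *
        (4 * (1 + v))⁻¹ := by gcongr
    _ = 4 * (d + 1).factorial * Real.exp 1 / r ^ d * (4 * (1 + v))⁻¹ := by
        rw [Real.exp_neg]; field_simp
    _ ≤ _ := by gcongr

end Gaussian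

/-! ### Gaussian mixtures and their Fourier transforms -/

section Mixture

variable {d : ℕ} {ν : Measure ℝ}

/-- The mixture of centred Gaussian densities with mixing law `ν`. -/
noncomputable def gaussMixture (ν : Measure ℝ) (x : EuclideanSpace ℝ (Fin d)) : ℝ :=
  ∫ s, gaussKernel s x ∂ν

lemma gaussMixture_nonneg (hν : ∀ᵐ s ∂ν, 0 < s) (x : EuclideanSpace ℝ (Fin d)) :
    0 ≤ gaussMixture ν x :=
  integral_nonneg_of_ae (hν.mono fun _ hs => gaussKernel_nonneg hs x)

variable [IsProbabilityMeasure ν]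

lemma integrable_gaussKernel_prod (hν : ∀ᵐ s ∂ν, 0 < s) :
    Integrable (fun p : ℝ × EuclideanSpace ℝ (Fin d) => gaussKernel p.1 p.2)
      (ν.prod volume) := by
  rw [integrable_prod_iff measurable_gaussKernel.aestronglyMeasurable]
  refine ⟨hν.mono fun s hs => integrable_gaussKernel hs, ?_⟩
  refine (integrable_const (1 : ℝ)).congr ?_
  filter_upwards [hν] with s hs
  simp_rw [Real.norm_of_nonneg (gaussKernel_nonneg hs _)]
  exact (integral_gaussKernel hs).symm

lemma integrable_gaussMixture (hν : ∀ᵐ s ∂ν, 0 < s) :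
    Integrable (gaussMixture ν : EuclideanSpace ℝ (Fin d) → ℝ) :=
  (integrable_gaussKernel_prod hν).integral_prod_right

lemma measurable_gaussMixture :
    Measurable (gaussMixture ν : EuclideanSpace ℝ (Fin d) → ℝ) :=
  (measurable_gaussKernel.stronglyMeasurable.integral_prod_left
    (f := fun s (x : EuclideanSpace ℝ (Fin d)) => gaussKernel s x)).measurable

/-- Fubini applies because the kernels are probability densities and `ν` is a probability measure.
-/
lemma charFun_withDensity_gaussMixture (hν : ∀ᵐ s ∂ν, 0 < s) (ξ : EuclideanSpace ℝ (Fin d)) :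
    charFun (volume.withDensity fun x => ENNReal.ofReal (gaussMixture ν x)) ξ =
      ((∫ s, Real.exp (-(‖ξ‖ ^ 2 * s)) ∂ν : ℝ) : ℂ) := by
  rw [charFun_apply, integral_withDensity_eq_integral_toReal_smul
    measurable_gaussMixture.ennreal_ofReal (by simp)]
  have hprod : Integrable (Function.uncurry fun (s : ℝ) (x : EuclideanSpace ℝ (Fin d)) =>
      Complex.exp (Complex.I * (inner ℝ x ξ : ℝ)) * (gaussKernel s x : ℂ)) (ν.prod volume) := by
    refine (integrable_gaussKernel_prod hν).ofReal.bdd_mul (c := 1) ?_ ?_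
    · fun_prop
    · refine Eventually.of_forall fun p => ?_
      rw [mul_comm, Complex.norm_exp_ofReal_mul_I]
  calc _ = ∫ x : EuclideanSpace ℝ (Fin d), ∫ s,
        Complex.exp (Complex.I * (inner ℝ x ξ : ℝ)) * (gaussKernel s x : ℂ) ∂ν := by
        refine integral_congr_ae (Eventually.of_forall fun x => ?_)
        simp only
        rw [ENNReal.toReal_ofReal (gaussMixture_nonneg hν x), integral_const_mul,
          integral_complex_ofReal, mul_comm Complex.I, Complex.real_smul, mul_comm]
        rfl
    _ = ∫ s, ∫ x : EuclideanSpace ℝ (Fin d),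
        Complex.exp (Complex.I * (inner ℝ x ξ : ℝ)) * (gaussKernel s x : ℂ) ∂volume ∂ν :=
        (integral_integral_swap hprod).symm
    _ = ∫ s, (Real.exp (-(‖ξ‖ ^ 2 * s)) : ℂ) ∂ν :=
        integral_congr_ae (hν.mono fun s hs => integral_cexp_mul_gaussKernel hs ξ)
    _ = _ := integral_complex_ofReal

/-- Fourier inversion for Gaussian mixtures with integrable characteristic function. -/
lemma integral_cexp_mul_laplace (hν : ∀ᵐ s ∂ν, 0 < s)
    (hint : Integrable fun ξ : EuclideanSpace ℝ (Fin d) => ∫ s, Real.exp (-(‖ξ‖ ^ 2 * s)) ∂ν)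
    (x : EuclideanSpace ℝ (Fin d)) :
    ∫ ξ : EuclideanSpace ℝ (Fin d), Complex.exp (Complex.I * (inner ℝ ξ x : ℝ)) *
      ((∫ s, Real.exp (-(‖ξ‖ ^ 2 * s)) ∂ν : ℝ) : ℂ) =
      (((2 * Real.pi) ^ d * gaussMixture ν x : ℝ) : ℂ) := by
  have hb : ∀ ξ : EuclideanSpace ℝ (Fin d),
      Integrable (fun s => Real.exp (-(‖ξ‖ ^ 2 * s))) ν := fun ξ => by
    refine (integrable_const (1 : ℝ)).mono' (by fun_prop) ?_
    filter_upwards [hν] with s hs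
    rw [Real.norm_of_nonneg (Real.exp_pos _).le, Real.exp_le_one_iff]
    have : 0 ≤ ‖ξ‖ ^ 2 * s := by positivity
    linarith
  -- The integrand is positive, so Tonelli turns `hint` into integrability on the product, which
  -- licenses the exchange of integrals.
  have hprod : Integrable (fun p : EuclideanSpace ℝ (Fin d) × ℝ =>
      Real.exp (-(‖p.1‖ ^ 2 * p.2))) (volume.prod ν) := by
    rw [integrable_prod_iff (by fun_prop)]
    refine ⟨Eventually.of_forall hb, ?_⟩
    simpa only [Real.norm_of_nonneg (Real.exp_pos _).le] using hint
  have hprod' : Integrable (Function.uncurry fun (ξ : EuclideanSpace ℝ (Fin d)) (s : ℝ) =>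
      Complex.exp (Complex.I * (inner ℝ ξ x : ℝ)) * (Real.exp (-(‖ξ‖ ^ 2 * s)) : ℂ))
      (volume.prod ν) := by
    refine hprod.ofReal.bdd_mul (c := 1) ?_ ?_
    · fun_prop
    · refine Eventually.of_forall fun p => ?_
      rw [mul_comm, Complex.norm_exp_ofReal_mul_I]
  have hπ := Real.pi_pos
  calc _ = ∫ ξ : EuclideanSpace ℝ (Fin d), ∫ s, Complex.exp (Complex.I * (inner ℝ ξ x : ℝ)) *
        (Real.exp (-(‖ξ‖ ^ 2 * s)) : ℂ) ∂ν := by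
        refine integral_congr_ae (Eventually.of_forall fun ξ => ?_)
        simp only
        rw [integral_const_mul, integral_complex_ofReal]
    _ = ∫ s, ∫ ξ : EuclideanSpace ℝ (Fin d), Complex.exp (Complex.I * (inner ℝ ξ x : ℝ)) *
        (Real.exp (-(‖ξ‖ ^ 2 * s)) : ℂ) ∂volume ∂ν :=
        integral_integral_swap hprod'
    _ = ∫ s, (((2 * Real.pi) ^ d * gaussKernel s x : ℝ) : ℂ) ∂ν := by
        refine integral_congr_ae (hν.mono fun s hs => ?_)
        simp only
        rw [integral_cexp_mul_exp_neg hs, gaussKernel, mul_inv_cancel_left₀ (by positivity)]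
    _ = _ := by rw [integral_complex_ofReal, integral_const_mul]; rfl

lemma gaussMixture_le (hν : ∀ᵐ s ∂ν, 0 < s) {x : EuclideanSpace ℝ (Fin d)} (hx : x ≠ 0) :
    gaussMixture ν x ≤ 4 * (d + 1).factorial * Real.exp 1 / ‖x‖ ^ d *
      (1 - ∫ s, Real.exp (-(‖x‖ ^ (-2 : ℤ) * s)) ∂ν) := by
  have hr : 0 < ‖x‖ := norm_pos_iff.2 hx
  have hi : Integrable (fun s => Real.exp (-(‖x‖ ^ (-2 : ℤ) * s))) ν := by
    refine (integrable_const (1 : ℝ)).mono' (by fun_prop) ?_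
    filter_upwards [hν] with s hs
    rw [Real.norm_of_nonneg (Real.exp_pos _).le, Real.exp_le_one_iff]
    have : 0 ≤ ‖x‖ ^ (-2 : ℤ) * s := by positivity
    linarith
  have h1 : (1 - ∫ s, Real.exp (-(‖x‖ ^ (-2 : ℤ) * s)) ∂ν) =
      ∫ s, (1 - Real.exp (-(‖x‖ ^ (-2 : ℤ) * s))) ∂ν := by
    rw [integral_sub (integrable_const _) hi]; simp
  rw [h1, ← integral_const_mul]
  exact integral_mono_of_nonneg (hν.mono fun s hs => gaussKernel_nonneg hs x)
    (((integrable_const _).sub hi).const_mul _) (hν.mono fun s hs => gaussKernel_le hs hx)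

end Mixture

end SubordinateBM

namespace SubordinateBM

/-! ### Brownian motion at independent random times -/

section TimeChange

variable {Ω : Type*} [MeasurableSpace Ω] {P : Measure Ω} {d : ℕ}
  {W : ℝ≥0 → Ω → EuclideanSpace ℝ (Fin d)}

lemma IsBrownianMotion.integral_cexp_sub (hW : IsBrownianMotion W P) {a b : ℝ≥0} (hab : a ≤ b)
    (ξ : EuclideanSpace ℝ (Fin d)) :
    ∫ ω, Complex.exp ((inner ℝ (W b ω - W a ω) ξ : ℝ) * Complex.I) ∂P =
      (Real.exp (-(‖ξ‖ ^ 2 * ((b : ℝ) - a))) : ℂ) := by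
  have hm : Measurable fun ω => W b ω - W a ω := (hW.measurable b).sub (hW.measurable a)
  have h := hW.charFun_increment a (b - a) ξ
  rw [add_tsub_cancel_of_le hab, charFun_apply, integral_map
    (f := fun x => Complex.exp ((inner ℝ x ξ : ℝ) * Complex.I)) hm.aemeasurable (by fun_prop)] at h
  rw [h, NNReal.coe_sub hab, mul_comm (‖ξ‖ ^ 2)]
  push_cast
  rfl

/-- Independent random times with values in a countable grid. -/
lemma IsBrownianMotion.integral_cexp_sub_of_nat [IsProbabilityMeasure P]
    (hW : IsBrownianMotion W P) {J K : Ω → ℕ}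
    (hJ : Measurable J) (hK : Measurable K) (hJK : ∀ᵐ ω ∂P, J ω ≤ K ω)
    (hind : IndepFun (fun ω t => W t ω) (fun ω => (J ω, K ω)) P) {g : ℕ → ℝ≥0}
    (hg : Monotone g) (ξ : EuclideanSpace ℝ (Fin d)) :
    ∫ ω, Complex.exp ((inner ℝ (W (g (K ω)) ω - W (g (J ω)) ω) ξ : ℝ) * Complex.I) ∂P =
      ∫ ω, (Real.exp (-(‖ξ‖ ^ 2 * ((g (K ω) : ℝ) - g (J ω)))) : ℂ) ∂P := by
  -- Restricting `W` to the grid leaves countably many coordinates and indices, so evaluation at a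
  -- random index is jointly measurable. Independence then allows the indices to be frozen.
  let Z : Ω → ℕ → EuclideanSpace ℝ (Fin d) := fun ω k => W (g k) ω
  let F : (ℕ → EuclideanSpace ℝ (Fin d)) × (ℕ × ℕ) → ℂ := fun p =>
    Complex.exp ((inner ℝ (p.1 p.2.2 - p.1 p.2.1) ξ : ℝ) * Complex.I)
  have hZ : Measurable Z := measurable_pi_lambda _ fun k => hW.measurable _
  have hJKm : Measurable fun ω => (J ω, K ω) := hJ.prodMk hK
  have hF : Measurable F := by
    refine measurable_from_prod_countable_left fun y => ?_
    have h1 : Measurable fun z : ℕ → EuclideanSpace ℝ (Fin d) => z y.2 - z y.1 :=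
      (measurable_pi_apply _).sub (measurable_pi_apply _)
    exact ((h1.inner_const).complex_ofReal.mul_const _).cexp
  have hind' : IndepFun Z (fun ω => (J ω, K ω)) P :=
    hind.comp (φ := fun (w : ℝ≥0 → EuclideanSpace ℝ (Fin d)) (k : ℕ) => w (g k)) (ψ := id)
      (measurable_pi_lambda _ fun k => measurable_pi_apply _) measurable_id
  have hlaw := (indepFun_iff_map_prod_eq_prod_map_map hZ.aemeasurable hJKm.aemeasurable).1 hind'
  have := Measure.isProbabilityMeasure_map (μ := P) hZ.aemeasurable
  have := Measure.isProbabilityMeasure_map (μ := P) hJKm.aemeasurable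
  have hFi : Integrable F ((P.map Z).prod (P.map fun ω => (J ω, K ω))) := by
    refine (integrable_const (1 : ℝ)).mono' hF.aestronglyMeasurable (Eventually.of_forall fun p => ?_)
    rw [Complex.norm_exp_ofReal_mul_I]
  calc _ = ∫ ω, F (Z ω, (J ω, K ω)) ∂P := rfl
    _ = ∫ p, F p ∂((P.map Z).prod (P.map fun ω => (J ω, K ω))) := by
        rw [← hlaw, integral_map (hZ.prodMk hJKm).aemeasurable hF.aestronglyMeasurable]
    _ = ∫ k, ∫ z, F (z, k) ∂(P.map Z) ∂(P.map fun ω => (J ω, K ω)) := integral_prod_symm _ hFi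
    _ = ∫ ω, ∫ z, F (z, (J ω, K ω)) ∂(P.map Z) ∂P :=
        integral_map hJKm.aemeasurable
          (measurable_of_countable _).aestronglyMeasurable
    _ = _ := by
        refine integral_congr_ae (hJK.mono fun ω hω => ?_)
        simp only
        have hFω : Measurable fun z => F (z, (J ω, K ω)) :=
          hF.comp (measurable_id.prodMk measurable_const)
        rw [integral_map hZ.aemeasurable hFω.aestronglyMeasurable]
        exact hW.integral_cexp_sub (hg hω) ξ

/-- The index of the last point of the lattice of mesh `1 / (n + 1)` that is at most `u`. -/
noncomputable def latticeIndex (n : ℕ) (u : ℝ≥0) : ℕ := ⌊u * ((n : ℝ≥0) + 1)⌋₊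

/-- The points of the lattice of mesh `1 / (n + 1)`. -/
noncomputable def latticePoint (n k : ℕ) : ℝ≥0 := k * ((n : ℝ≥0) + 1)⁻¹

lemma measurable_latticeIndex (n : ℕ) : Measurable (latticeIndex n) :=
  Nat.measurable_floor.comp (measurable_id.mul_const _)

lemma monotone_latticeIndex (n : ℕ) : Monotone (latticeIndex n) := fun _ _ huv =>
  Nat.floor_mono (mul_le_mul_left huv _)

lemma monotone_latticePoint (n : ℕ) : Monotone (latticePoint n) := fun _ _ hjk =>
  mul_le_mul_left (Nat.cast_le.2 hjk) _

lemma tendsto_latticePoint (u : ℝ≥0) :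
    Tendsto (fun n : ℕ => latticePoint n (latticeIndex n u)) atTop (𝓝 u) := by
  rw [← NNReal.tendsto_coe]
  have h := (tendsto_nat_floor_mul_div_atTop (R := ℝ) u.2).comp
    (tendsto_natCast_atTop_atTop.atTop_add (tendsto_const_nhds (x := (1 : ℝ))))
  refine h.congr fun n => ?_
  have : latticeIndex n u = ⌊(u : ℝ) * ((n : ℝ) + 1)⌋₊ := by
    refine Nat.floor_congr fun k => ?_
    rw [← NNReal.coe_le_coe]
    push_cast
    rfl
  simp [latticePoint, this, div_eq_mul_inv]

section Continuous

variable {U V : Ω → ℝ≥0}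

lemma IsBrownianMotion.tendsto_latticePoint (hW : IsBrownianMotion W P) (U : Ω → ℝ≥0) :
    ∀ᵐ ω ∂P, Tendsto (fun n : ℕ => W (latticePoint n (latticeIndex n (U ω))) ω) atTop
      (𝓝 (W (U ω) ω)) := by
  filter_upwards [hW.continuous] with ω hω
  exact (hω.tendsto _).comp (SubordinateBM.tendsto_latticePoint (U ω))

lemma IsBrownianMotion.measurable_latticePoint (hW : IsBrownianMotion W P) (hU : Measurable U)
    (n : ℕ) : Measurable fun ω => W (latticePoint n (latticeIndex n (U ω))) ω := by
  have h : Measurable fun p : ℕ × Ω => W (latticePoint n p.1) p.2 :=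
    measurable_from_prod_countable_right fun k => hW.measurable (latticePoint n k)
  exact h.comp (((measurable_latticeIndex n).comp hU).prodMk measurable_id)

/-- Paths are continuous only almost surely, so the value at a random time is obtained as an a.e.
limit of its lattice versions. -/
lemma IsBrownianMotion.aemeasurable_time (hW : IsBrownianMotion W P) (hU : Measurable U) :
    AEMeasurable (fun ω => W (U ω) ω) P :=
  aemeasurable_of_tendsto_metrizable_ae atTop
    (fun n => (hW.measurable_latticePoint hU n).aemeasurable) (hW.tendsto_latticePoint U)

/-- The characteristic function of a Brownian increment over an independent random interval. -/
lemma IsBrownianMotion.integral_cexp_sub_of_indepFun [IsProbabilityMeasure P]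
    (hW : IsBrownianMotion W P)
    (hU : Measurable U) (hV : Measurable V) (hUV : ∀ᵐ ω ∂P, U ω ≤ V ω)
    (hind : IndepFun (fun ω t => W t ω) (fun ω => (U ω, V ω)) P)
    (ξ : EuclideanSpace ℝ (Fin d)) :
    ∫ ω, Complex.exp ((inner ℝ (W (V ω) ω - W (U ω) ω) ξ : ℝ) * Complex.I) ∂P =
      ∫ ω, (Real.exp (-(‖ξ‖ ^ 2 * ((V ω : ℝ) - U ω))) : ℂ) ∂P := by
  -- Rounding down to the lattice preserves `U ≤ V`. Path continuity and domination by `1` then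
  -- remove the rounding on both sides.
  have key : ∀ n : ℕ,
      ∫ ω, Complex.exp ((inner ℝ (W (latticePoint n (latticeIndex n (V ω))) ω -
        W (latticePoint n (latticeIndex n (U ω))) ω) ξ : ℝ) * Complex.I) ∂P =
      ∫ ω, (Real.exp (-(‖ξ‖ ^ 2 * ((latticePoint n (latticeIndex n (V ω)) : ℝ) -
        latticePoint n (latticeIndex n (U ω))))) : ℂ) ∂P := fun n =>
    hW.integral_cexp_sub_of_nat ((measurable_latticeIndex n).comp hU)
      ((measurable_latticeIndex n).comp hV) (hUV.mono fun ω h => monotone_latticeIndex n h)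
      (hind.comp (φ := id) (ψ := fun p : ℝ≥0 × ℝ≥0 => (latticeIndex n p.1, latticeIndex n p.2))
        measurable_id (((measurable_latticeIndex n).comp measurable_fst).prodMk
          ((measurable_latticeIndex n).comp measurable_snd)))
      (monotone_latticePoint n) ξ
  refine tendsto_nhds_unique (tendsto_integral_of_dominated_convergence (fun _ => (1 : ℝ)) ?_
    (integrable_const _) ?_ ?_) ((tendsto_integral_of_dominated_convergence (fun _ => (1 : ℝ)) ?_
    (integrable_const _) ?_ ?_).congr fun n => (key n).symm)
  · intro n
    have h1 := (hW.measurable_latticePoint hV n).sub (hW.measurable_latticePoint hU n)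
    exact ((h1.inner_const).complex_ofReal.mul_const _).cexp.aestronglyMeasurable
  · exact fun n => Eventually.of_forall fun ω => by rw [Complex.norm_exp_ofReal_mul_I]
  · filter_upwards [hW.tendsto_latticePoint U, hW.tendsto_latticePoint V] with ω h1 h2
    have hc : Continuous fun x : EuclideanSpace ℝ (Fin d) =>
        Complex.exp ((inner ℝ x ξ : ℝ) * Complex.I) := by fun_prop
    exact (hc.tendsto _).comp (h2.sub h1)
  · intro n
    have hc : Measurable fun p : ℕ × ℕ =>
        (Real.exp (-(‖ξ‖ ^ 2 * ((latticePoint n p.2 : ℝ) - latticePoint n p.1))) : ℂ) :=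
      measurable_of_countable _
    exact (hc.comp (((measurable_latticeIndex n).comp hU).prodMk
      ((measurable_latticeIndex n).comp hV))).aestronglyMeasurable
  · intro n
    filter_upwards [hUV] with ω h
    rw [Complex.norm_real, Real.norm_of_nonneg (Real.exp_pos _).le, Real.exp_le_one_iff]
    have h3 := NNReal.coe_le_coe.2 (monotone_latticePoint n (monotone_latticeIndex n h))
    have := mul_nonneg (sq_nonneg ‖ξ‖) (sub_nonneg.2 h3)
    linarith
  · refine Eventually.of_forall fun ω => ?_
    have hu := NNReal.tendsto_coe.2 (SubordinateBM.tendsto_latticePoint (U ω))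
    have hv := NNReal.tendsto_coe.2 (SubordinateBM.tendsto_latticePoint (V ω))
    have hc : Continuous fun r : ℝ => (Real.exp (-(‖ξ‖ ^ 2 * r)) : ℂ) := by fun_prop
    exact (hc.tendsto _).comp (hv.sub hu)

end Continuous

end TimeChange

end SubordinateBM

namespace SubordinateBM

/-! ### From the Laplace transform of `S_t` to `p(t, ·)` -/

section Laplace

variable {d : ℕ} {φ : ℝ → ℝ} {ν : Measure ℝ} [IsProbabilityMeasure ν] {t : ℝ}

/-- A law whose Laplace transform vanishes at infinity is carried by `(0, ∞)`. -/
lemma ae_pos_of_laplace (ht : 0 < t) (hφ : Tendsto φ atTop atTop)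
    (hL : ∀ l : ℝ, 0 < l → ∫ s, Real.exp (-(l * s)) ∂ν = Real.exp (-(t * φ l))) :
    ∀ᵐ s ∂ν, 0 < s := by
  have hle : ∀ l : ℝ, 0 < l → ν.real (Set.Iic 0) ≤ Real.exp (-(t * φ l)) := fun l hl => by
    have hi : Integrable (fun s => Real.exp (-(l * s))) ν := by
      -- A non-integrable function would have integral `0`, but the transform is positive.
      by_contra hni
      have := hL l hl
      rw [integral_undef hni] at this
      exact (Real.exp_pos _).ne this
    -- Markov's inequality at level `1`: `exp (-l s) ≥ 1` for `s ≤ 0`.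
    have h := mul_meas_ge_le_integral_of_nonneg
      (Eventually.of_forall fun s => (Real.exp_pos (-(l * s))).le) hi 1
    rw [one_mul, hL l hl] at h
    refine le_trans (measureReal_mono fun s (hs : s ≤ 0) => ?_) h
    exact Real.one_le_exp (by nlinarith)
  have hlim : Tendsto (fun l => Real.exp (-(t * φ l))) atTop (𝓝 0) :=
    Real.tendsto_exp_neg_atTop_nhds_zero.comp (hφ.const_mul_atTop ht)
  have h0 : ν.real (Set.Iic 0) ≤ 0 := by
    refine ge_of_tendsto hlim ?_
    filter_upwards [eventually_gt_atTop 0] with l hl using hle l hl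
  have h1 : ν (Set.Iic 0) = 0 := by
    rw [← measureReal_eq_zero_iff]
    exact le_antisymm h0 measureReal_nonneg
  rw [ae_iff]
  simp only [not_lt]
  exact h1

lemma transitionDensity_eq_gaussMixture (hd : 1 ≤ d) (hν : ∀ᵐ s ∂ν, 0 < s)
    (hL : ∀ l : ℝ, 0 < l → ∫ s, Real.exp (-(l * s)) ∂ν = Real.exp (-(t * φ l)))
    (hint : Integrable fun ξ : EuclideanSpace ℝ (Fin d) => Real.exp (-(t * φ (‖ξ‖ ^ 2))))
    (x : EuclideanSpace ℝ (Fin d)) :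
    transitionDensity φ t x = gaussMixture ν x := by
  have : Nonempty (Fin d) := ⟨⟨0, hd⟩⟩
  have hne : ∀ᵐ ξ : EuclideanSpace ℝ (Fin d), ξ ≠ 0 := by
    simp [ae_iff]
  have hae : (fun ξ : EuclideanSpace ℝ (Fin d) => Real.exp (-(t * φ (‖ξ‖ ^ 2)))) =ᵐ[volume]
      fun ξ => ∫ s, Real.exp (-(‖ξ‖ ^ 2 * s)) ∂ν := by
    filter_upwards [hne] with ξ hξ
    exact (hL _ (pow_pos (norm_pos_iff.2 hξ) 2)).symm
  have h := integral_cexp_mul_laplace hν (hint.congr hae) x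
  have hπ := Real.pi_pos
  unfold transitionDensity
  rw [integral_congr_ae (g := fun ξ : EuclideanSpace ℝ (Fin d) =>
    Complex.exp (Complex.I * (inner ℝ ξ x : ℝ)) *
      ((∫ s, Real.exp (-(‖ξ‖ ^ 2 * s)) ∂ν : ℝ) : ℂ)), h, Complex.ofReal_re,
    inv_mul_cancel_left₀ (by positivity)]
  filter_upwards [hae] with ξ hξ
  rw [hξ]

lemma transitionDensity_le_integral (x : EuclideanSpace ℝ (Fin d)) :
    transitionDensity φ t x ≤
      ∫ ξ : EuclideanSpace ℝ (Fin d), Real.exp (-(t * φ (‖ξ‖ ^ 2))) := by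
  have hπ := Real.pi_gt_three
  have h1 : ((2 * Real.pi) ^ d)⁻¹ ≤ 1 := inv_le_one_of_one_le₀ (one_le_pow₀ (by linarith))
  have h2 : (∫ ξ : EuclideanSpace ℝ (Fin d), Complex.exp (Complex.I * (inner ℝ ξ x : ℝ)) *
      (Real.exp (-(t * φ (‖ξ‖ ^ 2))) : ℂ)).re ≤
      ∫ ξ : EuclideanSpace ℝ (Fin d), Real.exp (-(t * φ (‖ξ‖ ^ 2))) := by
    refine (Complex.re_le_norm _).trans ((norm_integral_le_integral_norm _).trans_eq ?_)
    refine integral_congr_ae (Eventually.of_forall fun ξ => ?_)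
    simp only
    rw [norm_mul, mul_comm Complex.I, Complex.norm_exp_ofReal_mul_I, one_mul, Complex.norm_real,
      Real.norm_of_nonneg (Real.exp_pos _).le]
  have h3 : 0 ≤ ∫ ξ : EuclideanSpace ℝ (Fin d), Real.exp (-(t * φ (‖ξ‖ ^ 2))) :=
    integral_nonneg fun ξ => (Real.exp_pos _).le
  unfold transitionDensity
  calc _ ≤ ((2 * Real.pi) ^ d)⁻¹ *
        ∫ ξ : EuclideanSpace ℝ (Fin d), Real.exp (-(t * φ (‖ξ‖ ^ 2))) := by gcongr
    _ ≤ _ := mul_le_of_le_one_left h3 h1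

end Laplace

/-! ### The law of the increments -/

section Increments

variable {Ω : Type*} [MeasurableSpace Ω] {P : Measure Ω} [IsProbabilityMeasure P] {d : ℕ}
  {W : ℝ≥0 → Ω → EuclideanSpace ℝ (Fin d)} {S : ℝ≥0 → Ω → ℝ≥0}

/-- The increments of a subordinate Brownian motion are Gaussian mixtures. -/
lemma map_subordinate_sub (hW : IsBrownianMotion W P) (hS : IsSubordinator S P)
    (hind : IndepFun (fun ω t => W t ω) (fun ω t => S t ω) P) {t : ℝ≥0}
    (hpos : ∀ᵐ r ∂(P.map fun ω => (S t ω : ℝ)), 0 < r) (s : ℝ≥0) :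
    P.map (fun ω => subordinate W S (s + t) ω - subordinate W S s ω) =
      volume.withDensity fun x =>
        ENNReal.ofReal (gaussMixture (P.map fun ω => (S t ω : ℝ)) x) := by
  have hm : ∀ r, Measurable fun ω => (S r ω : ℝ) := fun r => (hS.measurable r).coe_nnreal_real
  have := Measure.isProbabilityMeasure_map (μ := P) (hm t).aemeasurable
  have hX : AEMeasurable (fun ω => subordinate W S (s + t) ω - subordinate W S s ω) P :=
    (hW.aemeasurable_time (hS.measurable _)).sub (hW.aemeasurable_time (hS.measurable _))
  have := Measure.isProbabilityMeasure_map hX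
  have := isFiniteMeasure_withDensity_ofReal
    (integrable_gaussMixture (d := d) hpos).hasFiniteIntegral
  refine Measure.ext_of_charFun (funext fun ξ => ?_)
  rw [charFun_withDensity_gaussMixture hpos, charFun_apply, integral_map hX (by fun_prop)]
  have hd : Measurable fun ω => (S (s + t) ω : ℝ) - S s ω := (hm _).sub (hm _)
  have hind' : IndepFun (fun ω t => W t ω) (fun ω => (S s ω, S (s + t) ω)) P :=
    hind.comp (φ := id) (ψ := fun f : ℝ≥0 → ℝ≥0 => (f s, f (s + t))) measurable_id
      ((measurable_pi_apply _).prodMk (measurable_pi_apply _))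
  refine (hW.integral_cexp_sub_of_indepFun (hS.measurable s) (hS.measurable (s + t))
    (hS.monotone.mono fun ω h => h le_self_add) hind' ξ).trans ?_
  -- Stationarity replaces the law of `S_{s+t} - S_s` by that of `S_t`.
  rw [integral_complex_ofReal, ← hS.stationary s t, integral_map hd.aemeasurable (by fun_prop)]

end Increments

end SubordinateBM

/-! ### The density and its upper bound -/

open SubordinateBM in
theorem corollary3 (d : ℕ) (hd : 1 ≤ d) (φ : ℝ → ℝ) (hφ : IsDriftlessBernstein φ)
    (hφ_one : φ 1 = 1) (hH1 : H1 φ) (T : ℝ) (hT : 0 < T) :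
    ∃ N : ℝ, 0 < N ∧
      ∀ (Ω : Type*) [MeasurableSpace Ω] (P : Measure Ω) [IsProbabilityMeasure P]
        (W : ℝ≥0 → Ω → EuclideanSpace ℝ (Fin d)) (S : ℝ≥0 → Ω → ℝ≥0),
        IsBrownianMotion W P → IsSubordinator S P → HasLaplaceExponent S P φ →
        IndepFun (fun ω t => W t ω) (fun ω t => S t ω) P →
        ∀ t : ℝ≥0, 0 < t → (t : ℝ) ≤ T →
          -- `p(t, ·)` is the transition density of `X`
          (∀ s : ℝ≥0,
            P.map (fun ω => subordinate W S (s + t) ω - subordinate W S s ω) =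
              volume.withDensity
                (fun x => ENNReal.ofReal (transitionDensity φ (t : ℝ) x))) ∧
          -- the upper bound; the second term of the minimum is `+∞` at `x = 0`
          ∀ x : EuclideanSpace ℝ (Fin d),
            transitionDensity φ (t : ℝ) x
                ≤ N * (inverse φ (t : ℝ)⁻¹) ^ ((d : ℝ) / 2) ∧
            (x ≠ 0 →
              transitionDensity φ (t : ℝ) x
                ≤ N * min ((inverse φ (t : ℝ)⁻¹) ^ ((d : ℝ) / 2))
                    ((t : ℝ) * (φ (‖x‖ ^ (-2 : ℤ)) / ‖x‖ ^ d))) := by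

  -- `C` and `K` are fixed before the probability space and `t`, so `N` depends only on `T`, `d` and
  -- `φ`.
  obtain ⟨C, hC, hdiag⟩ := hφ.exists_integral_bound hφ_one hH1 hd hT
  let K : ℝ := 4 * (d + 1).factorial * Real.exp 1
  have hN : 0 < max C K := lt_max_of_lt_left hC
  refine ⟨max C K, hN, ?_⟩
  intro Ω _ P _ W S hW hS hL hind t ht htT
  have ht' : (0 : ℝ) < t := NNReal.coe_pos.2 ht
  obtain ⟨hint, hbound⟩ := hdiag t ht' htT
  have hm : Measurable fun ω => (S t ω : ℝ) := (hS.measurable t).coe_nnreal_real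
  have := Measure.isProbabilityMeasure_map (μ := P) hm.aemeasurable
  have hLν : ∀ l : ℝ, 0 < l → ∫ s, Real.exp (-(l * s)) ∂(P.map fun ω => (S t ω : ℝ)) =
      Real.exp (-(t * φ l)) := fun l hl => by
    rw [integral_map hm.aemeasurable (by fun_prop)]
    exact hL t l hl
  have hpos : ∀ᵐ r ∂(P.map fun ω => (S t ω : ℝ)), 0 < r :=
    ae_pos_of_laplace ht' (IsDriftlessBernstein.tendsto_atTop hφ_one hH1) hLν
  have hp : ∀ x : EuclideanSpace ℝ (Fin d), transitionDensity φ t x =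
      gaussMixture (P.map fun ω => (S t ω : ℝ)) x :=
    transitionDensity_eq_gaussMixture hd hpos hLν hint
  have hR := hφ.inverse_pos hφ_one hH1 (inv_pos.2 ht')
  have hon : ∀ x : EuclideanSpace ℝ (Fin d), transitionDensity φ t x ≤
      max C K * inverse φ (t : ℝ)⁻¹ ^ ((d : ℝ) / 2) := fun x =>
    ((transitionDensity_le_integral x).trans hbound).trans (by gcongr; exact le_max_left _ _)
  refine ⟨fun s => ?_, fun x => ⟨hon x, fun hx => ?_⟩⟩
  · simp_rw [hp]
    exact map_subordinate_sub hW hS hind hpos s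
  · rw [mul_min_of_nonneg _ _ hN.le]
    refine le_min (hon x) ?_
    have hr : 0 < ‖x‖ := norm_pos_iff.2 hx
    have hr2 : 0 < ‖x‖ ^ (-2 : ℤ) := by positivity
    have hφx := hφ.nonneg hr2
    have h := gaussMixture_le hpos hx
    rw [hLν _ hr2] at h
    rw [hp x]
    -- This is `1 - exp (-u) ≤ u` with `u = t φ(|x|⁻²)`.
    have he := Real.add_one_le_exp (-(t * φ (‖x‖ ^ (-2 : ℤ))))
    calc _ ≤ _ := h
      _ ≤ K / ‖x‖ ^ d * (t * φ (‖x‖ ^ (-2 : ℤ))) := by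
          refine mul_le_mul_of_nonneg_left (by linarith) (by positivity)
      _ = K * (t * (φ (‖x‖ ^ (-2 : ℤ)) / ‖x‖ ^ d)) := by ring
      _ ≤ _ := by gcongr; exact le_max_right _ _
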